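/- Let $M$ be a complex manifold of dimension $N$ and let $F$ be a holomorphic vector field on $M$. A function $\phi:M\to\mathbb C$ is called $F$-holomorphic if its restrictions to the integral curves of $F$ are holomorphic, i.e. if $\phi\circ\gamma$ is holomorphic for every holomorphic curve $\gamma:D\to M$, $D\subset\mathbb C$ open, with $\gamma'(\zeta)=F(\gamma(\zeta))$ for all $\zeta\in D$. For a critical point $z_0$ of $F$ (a point with $F(z_0)=0$), let $\operatorname{Sat}(z_0,F)$ be the union of all maximal integral curves $L$ of $F$ (the leaves of the singular holomorphic foliation defined by $F$) such that $L\cap U\neq\emptyset$ for every neighbourhood $U$ of $z_0$. Suppose that every critical point $z_0$ of $F$ is isolated and that $F$ is linearizable there with a diagonal matrix whose eigenvalues have positive ratios. That is, there is a biholomorphic map $w$ of a neighbourhood of $z_0$ onto an open subset of $\mathbb C^N$ such that in the coordinates $w$ one has $F(w)=Aw$, where $A=\operatorname{diag}(\alpha_1,\dots,\alpha_N)$ with all $\alpha_j\ne0$ and $\alpha_j/\alpha_k$ a positive real number for all $j,k$. Suppose also that $M$ is the union of the sets $\operatorname{Sat}(z_n,F)$ over all critical points $z_n$ of $F$. Then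 every $F$-holomorphic $C^\infty$ function $\phi:M\to\mathbb C$ is holomorphic on $M$. If in addition $M$ is compact and connected, then every such function is constant. -/

import Mathlib

open scoped Manifold ContDiff Topology

noncomputable section

/-- Holomorphy of a vector field `F`, as a section of the holomorphic tangent bundle of a
complex manifold modelled on `ℂ^N`. -/
def IsHolomorphicVectorField {N : ℕ} {M : Type*} [TopologicalSpace M]
    [ChartedSpace (EuclideanSpace ℂ (Fin N)) M]
    [IsManifold 𝓘(ℂ, EuclideanSpace ℂ (Fin N)) ω M]
    (F : (z : M) → TangentSpace 𝓘(ℂ, EuclideanSpace ℂ (Fin N)) z) : Prop :=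
  ContMDiff 𝓘(ℂ, EuclideanSpace ℂ (Fin N)) (𝓘(ℂ, EuclideanSpace ℂ (Fin N)).tangent) ω
    (fun z => (⟨z, F z⟩ : TangentBundle 𝓘(ℂ, EuclideanSpace ℂ (Fin N)) M))

/-- `γ` is an integral curve of `F` in complex time on `D ⊆ ℂ`: at every `ζ ∈ D` it is complex
differentiable with `γ'(ζ) = F (γ ζ)`. It is used for open `D` only. -/
def IsComplexIntegralCurveOn {N : ℕ} {M : Type*} [TopologicalSpace M]
    [ChartedSpace (EuclideanSpace ℂ (Fin N)) M]
    (F : (z : M) → TangentSpace 𝓘(ℂ, EuclideanSpace ℂ (Fin N)) z) (γ : ℂ → M) (D : Set ℂ) : Prop :=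
  ∀ ζ ∈ D, HasMFDerivAt 𝓘(ℂ, ℂ) 𝓘(ℂ, EuclideanSpace ℂ (Fin N)) γ ζ
    ((1 : ℂ →L[ℂ] ℂ).smulRight (F (γ ζ)))

/-- `φ` is `F`-holomorphic: it is holomorphic along every integral curve of `F`. -/
def IsFHolomorphic {N : ℕ} {M : Type*} [TopologicalSpace M]
    [ChartedSpace (EuclideanSpace ℂ (Fin N)) M]
    (F : (z : M) → TangentSpace 𝓘(ℂ, EuclideanSpace ℂ (Fin N)) z) (φ : M → ℂ) : Prop :=
  ∀ (D : Set ℂ) (γ : ℂ → M), IsOpen D → IsComplexIntegralCurveOn F γ D →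
    DifferentiableOn ℂ (φ ∘ γ) D

/-- `p` and `q` lie on one integral curve of `F` parametrized by a domain in `ℂ`. -/
def OnCommonIntegralCurve {N : ℕ} {M : Type*} [TopologicalSpace M]
    [ChartedSpace (EuclideanSpace ℂ (Fin N)) M]
    (F : (z : M) → TangentSpace 𝓘(ℂ, EuclideanSpace ℂ (Fin N)) z) (p q : M) : Prop :=
  ∃ (D : Set ℂ) (γ : ℂ → M), IsOpen D ∧ IsConnected D ∧ IsComplexIntegralCurveOn F γ D ∧
    p ∈ γ '' D ∧ q ∈ γ '' D

/-- The maximal integral curve of `F` through `p`, i.e. the leaf through `p` of the (singular)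
holomorphic foliation defined by `F`. The solution through `p` may become multivalued when
it is continued in complex time; so the leaf is obtained by joining points by finite chains of
integral curves defined on domains in `ℂ`. -/
def maximalIntegralCurve {N : ℕ} {M : Type*} [TopologicalSpace M]
    [ChartedSpace (EuclideanSpace ℂ (Fin N)) M]
    (F : (z : M) → TangentSpace 𝓘(ℂ, EuclideanSpace ℂ (Fin N)) z) (p : M) : Set M :=
  {q | Relation.ReflTransGen (OnCommonIntegralCurve F) p q}

/-- `Sat(z₀, F)`: the union of all maximal integral curves of `F` that meet every neighbourhood
of `z₀`. -/
def Sat {N : ℕ} {M : Type*} [TopologicalSpace M]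
    [ChartedSpace (EuclideanSpace ℂ (Fin N)) M]
    (F : (z : M) → TangentSpace 𝓘(ℂ, EuclideanSpace ℂ (Fin N)) z) (z₀ : M) : Set M :=
  ⋃₀ {L | (∃ p, L = maximalIntegralCurve F p) ∧ ∀ U ∈ 𝓝 z₀, (L ∩ U).Nonempty}

/-- `z₀` is a critical point of `F`. -/
def IsCriticalPoint {N : ℕ} {M : Type*} [TopologicalSpace M]
    [ChartedSpace (EuclideanSpace ℂ (Fin N)) M]
    (F : (z : M) → TangentSpace 𝓘(ℂ, EuclideanSpace ℂ (Fin N)) z) (z₀ : M) : Prop :=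
  F z₀ = 0

/-- `F` is linearizable at `z₀` with linearization matrix `A`: there are holomorphic coordinates
`w` near `z₀` (a chart of the maximal holomorphic atlas, that is, a biholomorphic map of an open
neighbourhood of `z₀` onto an open subset of `ℂ^N`) in which `F(w) = A w`. -/
def IsLinearizableAt {N : ℕ} {M : Type*} [TopologicalSpace M]
    [ChartedSpace (EuclideanSpace ℂ (Fin N)) M]
    (F : (z : M) → TangentSpace 𝓘(ℂ, EuclideanSpace ℂ (Fin N)) z) (z₀ : M)
    (A : Matrix (Fin N) (Fin N) ℂ) : Prop :=
  ∃ w ∈ IsManifold.maximalAtlas 𝓘(ℂ, EuclideanSpace ℂ (Fin N)) ω M, z₀ ∈ w.source ∧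
    ∀ z ∈ w.source,
      mfderiv 𝓘(ℂ, EuclideanSpace ℂ (Fin N)) 𝓘(ℂ, EuclideanSpace ℂ (Fin N)) w z (F z) =
        (WithLp.toLp 2 (A.mulVec (w z).ofLp) : EuclideanSpace ℂ (Fin N))

/-- `z₀` is an isolated critical point of `F` at which `F` is linearizable with a diagonal matrix
whose eigenvalues have pairwise positive real ratios (in particular they are non-zero, since
`0 / 0 = 0` is not positive). -/
def IsForelliCriticalPoint {N : ℕ} {M : Type*} [TopologicalSpace M]
    [ChartedSpace (EuclideanSpace ℂ (Fin N)) M]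
    (F : (z : M) → TangentSpace 𝓘(ℂ, EuclideanSpace ℂ (Fin N)) z) (z₀ : M) : Prop :=
  IsCriticalPoint F z₀ ∧ (∀ᶠ z in 𝓝[≠] z₀, ¬ IsCriticalPoint F z) ∧
    ∃ α : Fin N → ℂ, IsLinearizableAt F z₀ (Matrix.diagonal α) ∧
      ∀ j k, ∃ r : ℝ, 0 < r ∧ α j / α k = (r : ℂ)

end

/-! In a holomorphic chart, where `F` becomes a holomorphic field V, `F`-holomorphy of φ gives ∂̄_V
φ = 0: the antiholomorphic derivative in the single direction V vanishes
(`IsFHolomorphic.dbar_fieldIn_eq_zero`). The remaining directions are handled first near the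
critical points, then along the leaves.

Near a critical point, V is diagonal in suitable coordinates, and dividing by a common complex
factor makes its eigenvalues l_i positive. Differentiating ∂̄_V φ = 0 shows that g = ∂φ/∂z̄_k
satisfies ∂̄_V g = -l_k g. Any smooth g with ∂̄_V g = -μ g and μ > 0 vanishes at 0, and its first
derivatives solve the same equation with μ or μ + l_j in place of μ; by induction g is flat at 0
(`isBigO_pow_of_eigen`). On the curve c(t) = (e^{-l_i t} y_i) the function e^{-μ t̄} g(c(t)) is
holomorphic and bounded for Re t ≥ 0, and flatness makes it decay faster than every exponential on
the positive axis. By Phragmén–Lindelöf it is zero, and t = 0 gives g(y) = 0 (`eq_zero_of_eigen`).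

Along an integral curve γ, move vectors by the linearized equation Y' = V'(γ) Y. Then ζ ↦
∂̄φ(γ(ζ))(Y(ζ) e) is holomorphic, so by the identity theorem the vanishing of ∂̄φ spreads along γ
(`exists_ball_dbar_eq_zero_of_eventually`), and then through chains of curves to the whole leaf.
Every point of M lies on a leaf that enters the region of holomorphy around some critical point. In
the compact connected case the maximum principle finishes. -/

/-! ### Wirtinger calculus without coordinates. -/

section Wirtinger

open Complex

variable {E : Type*} [NormedAddCommGroup E] [NormedSpace ℂ E]

/-- The antiholomorphic directional derivative of `g` at `y` in the direction `e`. -/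
noncomputable def dbar (g : E → ℂ) (e y : E) : ℂ :=
  (fderiv ℝ g y e + I * fderiv ℝ g y (I • e)) / 2

/-- The holomorphic directional derivative of `g` at `y` in the direction `e`. -/
noncomputable def del (g : E → ℂ) (e y : E) : ℂ :=
  (fderiv ℝ g y e - I * fderiv ℝ g y (I • e)) / 2

theorem complex_smul_eq (c : ℂ) (e : E) : c • e = c.re • e + c.im • (I • e) := by
  conv_lhs => rw [← re_add_im c, add_smul, mul_smul]
  simp

theorem dbar_smul (g : E → ℂ) (c : ℂ) (e y : E) :
    dbar g (c • e) y = (starRingEnd ℂ) c * dbar g e y := by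
  have h : I • c • e = c.re • (I • e) - c.im • e := by
    rw [complex_smul_eq c e, smul_add, smul_comm I c.re e, smul_comm I c.im (I • e), smul_smul I I e]
    simp [sub_eq_add_neg]
  have hc : (starRingEnd ℂ) c = c.re - c.im * I := by
    apply Complex.ext <;> simp
  simp only [dbar]
  rw [h, complex_smul_eq c e, hc]
  simp only [map_add, map_sub, map_smul, real_smul]
  linear_combination (c.im * fderiv ℝ g y (I • e) / 2) * I_sq

@[simp] theorem dbar_zero (g : E → ℂ) (y : E) : dbar g 0 y = 0 := by
  simp [dbar]

theorem dbar_sum {ι : Type*} (s : Finset ι) (g : E → ℂ) (e : ι → E) (y : E) :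
    dbar g (∑ i ∈ s, e i) y = ∑ i ∈ s, dbar g (e i) y := by
  simp only [dbar, Finset.smul_sum, map_sum, Finset.mul_sum, ← Finset.sum_add_distrib,
    Finset.sum_div]

theorem fderiv_smul_eq (g : E → ℂ) (c : ℂ) (e y : E) :
    fderiv ℝ g y (c • e) = c * del g e y + (starRingEnd ℂ) c * dbar g e y := by
  have hc : (starRingEnd ℂ) c = c.re - c.im * I := by
    apply Complex.ext <;> simp
  rw [complex_smul_eq c e, hc]
  conv_rhs => rw [← re_add_im c]
  simp only [map_add, map_smul, real_smul, del, dbar, add_re, ofReal_re, mul_re, I_re, mul_zero,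
    ofReal_im, I_im, mul_one, sub_self, add_zero, add_im, mul_im, zero_add]
  linear_combination (c.im * fderiv ℝ g y (I • e)) * I_sq

theorem differentiableAt_of_dbar_eq_zero {g : E → ℂ} {y : E} (hg : DifferentiableAt ℝ g y)
    (h : ∀ e, dbar g e y = 0) : DifferentiableAt ℂ g y := by
  rw [differentiableAt_iff_restrictScalars ℝ hg]
  have key : ∀ (c : ℂ) (e : E), fderiv ℝ g y (c • e) = c * fderiv ℝ g y e := by
    intro c e
    have h1 := fderiv_smul_eq g 1 e y
    rw [one_smul] at h1
    rw [fderiv_smul_eq, h1]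
    simp [h]
  exact ⟨{ toFun := fderiv ℝ g y
           map_add' := map_add _
           map_smul' := key
           cont := (fderiv ℝ g y).continuous }, rfl⟩

theorem dbar_eq_zero_of_differentiableAt {g : E → ℂ} {y : E} (hg : DifferentiableAt ℂ g y) (e : E) :
    dbar g e y = 0 := by
  simp only [dbar, hg.fderiv_restrictScalars ℝ, ContinuousLinearMap.coe_restrictScalars', map_smul,
    smul_eq_mul]
  linear_combination (fderiv ℂ g y e / 2) * I_sq

theorem differentiableAt_of_dbar_one_eq_zero {g : ℂ → ℂ} {y : ℂ} (hg : DifferentiableAt ℝ g y)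
    (h : dbar g 1 y = 0) : DifferentiableAt ℂ g y :=
  differentiableAt_of_dbar_eq_zero hg fun e => by
    have := dbar_smul g e 1 y
    rw [smul_eq_mul, mul_one] at this
    rw [this, h, mul_zero]

theorem hasFDerivAt_real_of_hasDerivAt {γ : ℂ → E} {ζ : ℂ} {v : E} (hγ : HasDerivAt γ v ζ) :
    HasFDerivAt γ (((1 : ℂ →L[ℂ] ℂ).smulRight v).restrictScalars ℝ) ζ :=
  hγ.hasFDerivAt.restrictScalars ℝ

theorem dbar_comp {g : E → ℂ} {γ : ℂ → E} {ζ : ℂ} {v : E} (hg : DifferentiableAt ℝ g (γ ζ))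
    (hγ : HasDerivAt γ v ζ) : dbar (g ∘ γ) 1 ζ = dbar g v (γ ζ) := by
  simp only [dbar]
  rw [(hg.hasFDerivAt.comp ζ (hasFDerivAt_real_of_hasDerivAt hγ)).fderiv]
  simp

theorem dbar_mul {f g : E → ℂ} {y : E} (e : E) (hf : DifferentiableAt ℝ f y)
    (hg : DifferentiableAt ℝ g y) :
    dbar (fun z => f z * g z) e y = f y * dbar g e y + dbar f e y * g y := by
  simp only [dbar]
  rw [fderiv_fun_mul hf hg]
  simp
  ring

theorem dbar_neg_mul (g : E → ℂ) (c : ℂ) (e y : E)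
    (hg : DifferentiableAt ℝ g y) : dbar (fun z => -c * g z) e y = -c * dbar g e y := by
  simp only [dbar]
  rw [fderiv_const_mul hg]
  simp
  ring

theorem del_neg_mul (g : E → ℂ) (c : ℂ) (e y : E)
    (hg : DifferentiableAt ℝ g y) : del (fun z => -c * g z) e y = -c * del g e y := by
  simp only [del]
  rw [fderiv_const_mul hg]
  simp
  ring

theorem contDiffAt_dbar {g : E → ℂ} {y : E} (hg : ContDiffAt ℝ ∞ g y) (e : E) :
    ContDiffAt ℝ ∞ (dbar g e) y := by
  have h : ContDiffAt ℝ ∞ (fderiv ℝ g) y := hg.fderiv_right (by simp)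
  unfold dbar
  fun_prop

theorem contDiffAt_del {g : E → ℂ} {y : E} (hg : ContDiffAt ℝ ∞ g y) (e : E) :
    ContDiffAt ℝ ∞ (del g e) y := by
  have h : ContDiffAt ℝ ∞ (fderiv ℝ g) y := hg.fderiv_right (by simp)
  unfold del
  fun_prop

/-- Derivative of an antiholomorphic derivative in a varying direction. -/
theorem fderiv_dbar_apply {F : Type*} [NormedAddCommGroup F] [NormedSpace ℝ F]
    {g : E → ℂ} {p : F → E} {W : F → E} {p' W' : F →L[ℝ] E} {x : F}
    (hg : ContDiffAt ℝ ∞ g (p x)) (hp : HasFDerivAt p p' x) (hW : HasFDerivAt W W' x) :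
    HasFDerivAt (fun z => dbar g (W z) (p z))
      ((2⁻¹ : ℂ) • ((fderiv ℝ (fderiv ℝ g) (p x)).comp p').flip (W x) +
        (2⁻¹ : ℂ) • (fderiv ℝ g (p x)).comp W' +
        ((2⁻¹ * I : ℂ) • ((fderiv ℝ (fderiv ℝ g) (p x)).comp p').flip (I • W x) +
        (2⁻¹ * I : ℂ) • (fderiv ℝ g (p x)).comp (I • W'))) x := by
  have h : ContDiffAt ℝ ∞ (fderiv ℝ g) (p x) := hg.fderiv_right (by simp)
  have h1 : HasFDerivAt (fun z => fderiv ℝ g (p z)) ((fderiv ℝ (fderiv ℝ g) (p x)).comp p') x :=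
    (h.differentiableAt (by simp)).hasFDerivAt.comp x hp
  have h2 := h1.clm_apply hW
  have h3 := h1.clm_apply (hW.const_smul I)
  have h4 := (h2.const_smul (2⁻¹ : ℂ)).add (h3.const_smul (2⁻¹ * I : ℂ))
  refine (h4.congr_of_eventuallyEq (Filter.Eventually.of_forall fun z => ?_)).congr_fderiv ?_
  · simp [dbar]
    ring
  · ext u
    simp
    ring

/-- The commutation relation of `dbar` with the antiholomorphic derivative along a holomorphic
vector field. -/
theorem dbar_dbar_of_vectorField {g h : E → ℂ} {V : E → E} {V' : E →L[ℂ] E} {y : E}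
    (hg : ContDiffAt ℝ ∞ g y) (hV : HasFDerivAt V V' y)
    (hh : ∀ᶠ z in 𝓝 y, dbar g (V z) z = h z) (e : E) :
    dbar (dbar g e) (V y) y = dbar h e y - dbar g (V' e) y := by
  have hS : IsSymmSndFDerivAt ℝ g y := hg.isSymmSndFDerivAt (by simpa using ENat.LEInfty.out)
  have hf := (fderiv_dbar_apply hg (hasFDerivAt_id y) (hV.restrictScalars ℝ)).congr_of_eventuallyEq
    (hh.mono fun z hz => hz.symm)
  have he := (fderiv_dbar_apply hg (hasFDerivAt_id y) (hasFDerivAt_const e y))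
  have e1 : fderiv ℝ h y = _ := hf.fderiv
  have e2 : fderiv ℝ (dbar g e) y = _ := he.fderiv
  simp only [dbar] at e2 ⊢
  rw [e1, e2]
  simp
  rw [hS.eq (V y) e, hS.eq (V y) (I • e), hS.eq (I • V y) e, hS.eq (I • V y) (I • e)]
  simp only [smul_smul, I_mul_I, neg_smul, one_smul, map_neg]
  linear_combination (fderiv ℝ g y (V' e) / 4) * I_sq

/-- The coefficients of ∂̄_V are the conjugates of those of V, and ∂_e annihilates them because V is
holomorphic; hence no term in `V'`, in contrast to the commutation with `dbar g e`. -/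
theorem dbar_del_of_vectorField {g h : E → ℂ} {V : E → E} {V' : E →L[ℂ] E} {y : E}
    (hg : ContDiffAt ℝ ∞ g y) (hV : HasFDerivAt V V' y)
    (hh : ∀ᶠ z in 𝓝 y, dbar g (V z) z = h z) (e : E) :
    dbar (del g e) (V y) y = del h e y := by
  have hS : IsSymmSndFDerivAt ℝ g y := hg.isSymmSndFDerivAt (by simpa using ENat.LEInfty.out)
  have hf := (fderiv_dbar_apply hg (hasFDerivAt_id y) (hV.restrictScalars ℝ)).congr_of_eventuallyEq
    (hh.mono fun z hz => hz.symm)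
  have hd : ContDiffAt ℝ ∞ (fderiv ℝ g) y := hg.fderiv_right (by simp)
  have h1 := (hd.differentiableAt (by simp)).hasFDerivAt
  have h2 := ((h1.clm_apply (hasFDerivAt_const e y)).sub
    ((h1.clm_apply (hasFDerivAt_const (I • e) y)).const_smul I)).const_smul (2⁻¹ : ℂ)
  have he := h2.congr_of_eventuallyEq (f₁ := del g e) (Filter.Eventually.of_forall fun z => by
    simp [del]
    ring)
  simp only [dbar]
  rw [he.fderiv]
  simp only [del]
  rw [hf.fderiv]
  simp
  rw [hS.eq (V y) e, hS.eq (V y) (I • e), hS.eq (I • V y) e, hS.eq (I • V y) (I • e)]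
  simp only [smul_smul, I_mul_I, neg_smul, one_smul, map_neg]
  linear_combination (-fderiv ℝ g y (V' e) / 2) * I_sq

end Wirtinger

/-! ### Holomorphic differential equations in complex time. -/

section ComplexODE

open Metric Filter
open scoped NNReal

variable {E : Type*} [NormedAddCommGroup E] [NormedSpace ℂ E]

/-- Cauchy's existence theorem for holomorphic differential equations in complex time. -/
theorem exists_hasDerivAt_complex_of_contDiffAt [CompleteSpace E] {f : E → E} {y₀ : E}
    (hf : ContDiffAt ℂ 1 f y₀) (ζ₀ : ℂ) :
    ∃ r > 0, ∃ y : ℂ → E, y ζ₀ = y₀ ∧ ∀ ζ ∈ ball ζ₀ r, HasDerivAt y (f (y ζ)) ζ := by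
  obtain ⟨K, t, ht, hK⟩ := hf.exists_lipschitzOnWith
  have hd : ∀ᶠ z in 𝓝 y₀, DifferentiableAt ℂ f z :=
    (hf.eventually (by simp)).mono fun z hz => hz.differentiableAt (by simp)
  obtain ⟨a, ha, hat⟩ := nhds_basis_closedBall.mem_iff.1 (inter_mem ht hd)
  set B := closedBall y₀ a with hB
  have hKB : LipschitzOnWith K f B := hK.mono fun z hz => (hat hz).1
  have hdB : ∀ z ∈ B, DifferentiableAt ℂ f z := fun z hz => (hat hz).2
  have hy₀ : y₀ ∈ B := mem_closedBall_self ha.le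
  obtain ⟨C, hC0, hC⟩ : ∃ C : ℝ, 0 < C ∧ ∀ z ∈ B, ‖f z‖ ≤ C := by
    refine ⟨‖f y₀‖ + K * a + 1, by positivity, fun z hz => ?_⟩
    have h1 := hKB.dist_le_mul z hz y₀ hy₀
    have h2 : (K : ℝ) * dist z y₀ ≤ K * a := by gcongr; exact hz
    have h3 : ‖f z‖ ≤ ‖f z - f y₀‖ + ‖f y₀‖ := by
      simpa using norm_add_le (f z - f y₀) (f y₀)
    rw [dist_eq_norm] at h1
    linarith
  -- `C * r ≤ a` keeps the Picard iterates in `B`; `K * r ≤ 1 / 2` makes the iteration contract by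
  -- the factor 1/2.
  obtain ⟨r, hr, hrC, hrK⟩ : ∃ r : ℝ, 0 < r ∧ C * r ≤ a ∧ K * r ≤ 1 / 2 := by
    refine ⟨min (a / C) (1 / (2 * (K + 1))), by positivity, ?_, ?_⟩
    · calc C * _ ≤ C * (a / C) := by gcongr; exact min_le_left _ _
        _ = a := by field_simp
    · calc (K : ℝ) * _ ≤ (K + 1) * (1 / (2 * (K + 1))) := by
            gcongr
            · simp
            · exact min_le_right _ _
        _ = 1 / 2 := by field_simp
  have hζ₀ : ζ₀ ∈ ball ζ₀ r := mem_ball_self hr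
  let S := {y : ℂ → E // DifferentiableOn ℂ y (ball ζ₀ r) ∧ ∀ ζ ∈ ball ζ₀ r, y ζ ∈ B}
  have step : ∀ y : S, ∃ y' : S, y'.1 ζ₀ = y₀ ∧
      ∀ ζ ∈ ball ζ₀ r, HasDerivAt y'.1 (f (y.1 ζ)) ζ := by
    rintro ⟨y, hy, hyB⟩
    have h1 : DifferentiableOn ℂ (fun ζ => f (y ζ)) (ball ζ₀ r) := fun ζ hζ =>
      ((hdB _ (hyB ζ hζ)).comp ζ (hy.differentiableAt (isOpen_ball.mem_nhds hζ))
        ).differentiableWithinAt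
    obtain ⟨p, hp0, hp⟩ := h1.isExactOn_ball.with_val_at ζ₀ y₀
    refine ⟨⟨p, fun ζ hζ => (hp ζ hζ).differentiableAt.differentiableWithinAt, fun ζ hζ => ?_⟩,
      hp0, hp⟩
    have h2 := (convex_ball ζ₀ r).norm_image_sub_le_of_norm_hasDerivWithin_le
      (fun x hx => (hp x hx).hasDerivWithinAt) (fun x hx => hC _ (hyB x hx)) hζ₀ hζ
    rw [hp0] at h2
    rw [hB, mem_closedBall, dist_eq_norm]
    refine h2.trans (le_trans ?_ hrC)
    gcongr
    exact (mem_ball_iff_norm.1 hζ).le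
  choose T hT0 hT using step
  let u : ℕ → S := fun n => n.rec ⟨fun _ => y₀, by simp, fun _ _ => hy₀⟩ fun _ y => T y
  have hu : ∀ n, u (n + 1) = T (u n) := fun n => rfl
  have hgeo : ∀ n, ∀ ζ ∈ ball ζ₀ r,
      dist ((u n).1 ζ) ((u (n + 1)).1 ζ) ≤ 2 * a * (1 / 2) ^ n := by
    intro n
    induction n with
    | zero =>
      intro ζ hζ
      have h1 : dist ((u 0).1 ζ) y₀ ≤ a := (u 0).2.2 ζ hζ
      have h2 : dist ((u 1).1 ζ) y₀ ≤ a := (u 1).2.2 ζ hζ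
      have := dist_triangle_right ((u 0).1 ζ) ((u 1).1 ζ) y₀
      simp only [zero_add, pow_zero, mul_one]
      linarith
    | succ n ih =>
      intro ζ hζ
      have hder : ∀ x ∈ ball ζ₀ r, HasDerivAt (fun x => (u (n + 1)).1 x - (u (n + 2)).1 x)
          (f ((u n).1 x) - f ((u (n + 1)).1 x)) x := fun x hx =>
        (hT (u n) x hx).sub (hT (u (n + 1)) x hx)
      have h2 := (convex_ball ζ₀ r).norm_image_sub_le_of_norm_hasDerivWithin_le
        (C := K * (2 * a * (1 / 2) ^ n))
        (fun x hx => (hder x hx).hasDerivWithinAt) (fun x hx => by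
          rw [← dist_eq_norm]
          refine (hKB.dist_le_mul _ ((u n).2.2 x hx) _ ((u (n + 1)).2.2 x hx)).trans ?_
          gcongr
          exact ih x hx) hζ₀ hζ
      have h3 : (u (n + 1)).1 ζ₀ - (u (n + 2)).1 ζ₀ = 0 := by
        rw [hu n, hu (n + 1), hT0, hT0, sub_self]
      rw [h3, sub_zero, ← dist_eq_norm] at h2
      refine h2.trans ?_
      have h4 : ‖ζ - ζ₀‖ ≤ r := (mem_ball_iff_norm.1 hζ).le
      calc K * (2 * a * (1 / 2) ^ n) * ‖ζ - ζ₀‖ ≤ K * (2 * a * (1 / 2) ^ n) * r := by gcongr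
        _ = K * r * (2 * a * (1 / 2) ^ n) := by ring
        _ ≤ 1 / 2 * (2 * a * (1 / 2) ^ n) := by gcongr
        _ = _ := by ring
  have hlim : ∀ ζ, ∃ z, ζ ∈ ball ζ₀ r → Tendsto (fun n => (u n).1 ζ) atTop (𝓝 z) := by
    intro ζ
    by_cases hζ : ζ ∈ ball ζ₀ r
    · obtain ⟨z, hz⟩ := cauchySeq_tendsto_of_complete
        (cauchySeq_of_le_geometric (1 / 2) (2 * a) (by norm_num) fun n => hgeo n ζ hζ)
      exact ⟨z, fun _ => hz⟩
    · exact ⟨0, fun h => absurd h hζ⟩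
  choose y hy using hlim
  have hyB : ∀ ζ ∈ ball ζ₀ r, y ζ ∈ B := fun ζ hζ =>
    isClosed_closedBall.mem_of_tendsto (hy ζ hζ) (Eventually.of_forall fun n => (u n).2.2 ζ hζ)
  have hunif : TendstoUniformlyOn (fun n ζ => f ((u n).1 ζ)) (fun ζ => f (y ζ)) atTop
      (ball ζ₀ r) := by
    rw [Metric.tendstoUniformlyOn_iff]
    intro ε hε
    have h0 : Tendsto (fun n : ℕ => K * (2 * a * (1 / 2) ^ n / (1 - 1 / 2)) : ℕ → ℝ)
        atTop (𝓝 0) := by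
      have := (tendsto_pow_atTop_nhds_zero_of_lt_one (r := (1 / 2 : ℝ)) (by norm_num)
        (by norm_num)).const_mul (K * (2 * a) / (1 - 1 / 2))
      rw [mul_zero] at this
      exact this.congr fun n => by ring
    filter_upwards [h0.eventually_lt_const hε] with n hn ζ hζ
    refine lt_of_le_of_lt ?_ hn
    rw [dist_comm]
    refine (hKB.dist_le_mul _ ((u n).2.2 ζ hζ) _ (hyB ζ hζ)).trans ?_
    gcongr
    exact dist_le_of_le_geometric_of_tendsto (1 / 2) (2 * a) (by norm_num)
      (fun n => hgeo n ζ hζ) (hy ζ hζ) n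
  refine ⟨r, hr, y, ?_, fun ζ hζ => ?_⟩
  · refine tendsto_nhds_unique (hy ζ₀ hζ₀) (tendsto_const_nhds.congr' ?_)
    filter_upwards [eventually_ge_atTop 1] with n hn
    obtain ⟨m, rfl⟩ := Nat.exists_eq_add_of_le' hn
    rw [hu, hT0]
  -- The index is shifted because the derivative of iterate n + 1 is `f` of iterate n.
  · refine hasDerivAt_of_tendstoUniformlyOn isOpen_ball hunif
      (f := fun n => (u (n + 1)).1) (Eventually.of_forall fun n x hx => hT (u n) x hx)
      (fun x hx => (hy x hx).comp (tendsto_add_atTop_nat 1)) hζ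

/-- Local uniqueness for holomorphic differential equations in complex time. -/
theorem eventuallyEq_of_hasDerivAt_complex {f : E → E} {y₁ y₂ : ℂ → E} {ζ₀ : ℂ}
    (hf : ContDiffAt ℂ 1 f (y₁ ζ₀)) (h0 : y₁ ζ₀ = y₂ ζ₀)
    (h1 : ∀ᶠ ζ in 𝓝 ζ₀, HasDerivAt y₁ (f (y₁ ζ)) ζ)
    (h2 : ∀ᶠ ζ in 𝓝 ζ₀, HasDerivAt y₂ (f (y₂ ζ)) ζ) : y₁ =ᶠ[𝓝 ζ₀] y₂ := by
  obtain ⟨K, t, ht, hK⟩ := hf.exists_lipschitzOnWith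
  have c1 := h1.self_of_nhds.continuousAt.eventually ht
  have c2 := h2.self_of_nhds.continuousAt.eventually (h0 ▸ ht)
  obtain ⟨ρ, hρ, hρt⟩ := nhds_basis_closedBall.eventually_iff.1 (h1.and (h2.and (c1.and c2)))
  obtain ⟨r, hr, hrρ, hrK⟩ : ∃ r : ℝ, 0 < r ∧ r ≤ ρ ∧ K * r ≤ 1 / 2 := by
    refine ⟨min ρ (1 / (2 * (K + 1))), by positivity, min_le_left _ _, ?_⟩
    calc (K : ℝ) * _ ≤ (K + 1) * (1 / (2 * (K + 1))) := by
          gcongr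
          · simp
          · exact min_le_right _ _
      _ = 1 / 2 := by field_simp
  have hsub : closedBall ζ₀ r ⊆ closedBall ζ₀ ρ := closedBall_subset_closedBall hrρ
  have hder : ∀ x ∈ closedBall ζ₀ r,
      HasDerivAt (fun x => y₁ x - y₂ x) (f (y₁ x) - f (y₂ x)) x := fun x hx =>
    (hρt (hsub hx)).1.sub (hρt (hsub hx)).2.1
  -- At a point of maximal distance between the solutions, the mean value inequality bounds that
  -- distance by half of itself.
  obtain ⟨m, hm, hmax⟩ := (isCompact_closedBall ζ₀ r).exists_isMaxOn
    ⟨ζ₀, mem_closedBall_self hr.le⟩ (f := fun x => ‖y₁ x - y₂ x‖)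
    (fun x hx => (hder x hx).continuousAt.norm.continuousWithinAt)
  have hb := (convex_closedBall ζ₀ r).norm_image_sub_le_of_norm_hasDerivWithin_le
    (C := K * ‖y₁ m - y₂ m‖) (fun x hx => (hder x hx).hasDerivWithinAt) (fun x hx => by
      rw [← dist_eq_norm]
      refine (hK.dist_le_mul _ (hρt (hsub hx)).2.2.1 _ (hρt (hsub hx)).2.2.2).trans ?_
      gcongr
      rw [dist_eq_norm]
      exact hmax hx) (mem_closedBall_self hr.le) hm
  simp only [h0, sub_self, sub_zero] at hb
  have hz : ‖y₁ m - y₂ m‖ ≤ 1 / 2 * ‖y₁ m - y₂ m‖ := by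
    refine hb.trans ?_
    have := mem_closedBall_iff_norm.1 hm
    calc K * ‖y₁ m - y₂ m‖ * ‖m - ζ₀‖ ≤ K * ‖y₁ m - y₂ m‖ * r := by gcongr
      _ = K * r * ‖y₁ m - y₂ m‖ := by ring
      _ ≤ _ := by gcongr
  filter_upwards [closedBall_mem_nhds ζ₀ hr] with x hx
  have : ‖y₁ x - y₂ x‖ ≤ ‖y₁ m - y₂ m‖ := hmax hx
  rw [← sub_eq_zero, ← norm_le_zero_iff]
  linarith

end ComplexODE

/-! ### Diagonal linear fields: flatness and Phragmén–Lindelöf. -/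

section LinearCriticalPoint

open Complex Filter Metric Asymptotics

variable {ι : Type*} [Fintype ι] [DecidableEq ι]

/-- The diagonal linear vector field with eigenvalues `c`. -/
noncomputable def diagCLM (c : ι → ℂ) : EuclideanSpace ℂ ι →L[ℂ] EuclideanSpace ℂ ι :=
  Matrix.toEuclideanCLM (𝕜 := ℂ) (Matrix.diagonal c)

theorem diagCLM_eq (c : ι → ℂ) (y : EuclideanSpace ℂ ι) :
    diagCLM c y = WithLp.toLp 2 ((Matrix.diagonal c).mulVec y.ofLp) := rfl

@[simp] theorem diagCLM_apply (c : ι → ℂ) (y : EuclideanSpace ℂ ι) (i : ι) :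
    diagCLM c y i = c i * y i := by
  simp [diagCLM_eq, Matrix.mulVec_diagonal]

theorem diagCLM_single (c : ι → ℂ) (k : ι) :
    diagCLM c (EuclideanSpace.single k 1) = c k • EuclideanSpace.single k (1 : ℂ) := by
  ext i
  by_cases h : i = k
  · subst h; simp
  · simp [h]

theorem norm_diagCLM_le {c : ι → ℂ} {R : ℝ} (hR : 0 ≤ R) (h : ∀ i, ‖c i‖ ≤ R)
    (y : EuclideanSpace ℂ ι) : ‖diagCLM c y‖ ≤ R * ‖y‖ := by
  rw [EuclideanSpace.norm_eq, EuclideanSpace.norm_eq, ← Real.sqrt_sq hR,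
    ← Real.sqrt_mul (sq_nonneg R), Finset.mul_sum]
  refine Real.sqrt_le_sqrt (Finset.sum_le_sum fun i _ => ?_)
  rw [diagCLM_apply, norm_mul, mul_pow]
  gcongr
  exact h i

theorem sum_smul_single (y : EuclideanSpace ℂ ι) :
    ∑ i, y i • EuclideanSpace.single i (1 : ℂ) = y := by
  ext j
  simp [Finset.sum_apply, Pi.single_apply]

/-- Only the Wirtinger derivatives remain eigenfunctions; this converts estimates on them into the
real derivative bound needed for the mean value inequality. -/
theorem norm_fderiv_le_sum (g : EuclideanSpace ℂ ι → ℂ) (y : EuclideanSpace ℂ ι) :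
    ‖fderiv ℝ g y‖ ≤ ∑ k, (‖del g (EuclideanSpace.single k 1) y‖ +
      ‖dbar g (EuclideanSpace.single k 1) y‖) := by
  refine ContinuousLinearMap.opNorm_le_bound _ (by positivity) fun x => ?_
  conv_lhs => rw [← sum_smul_single x]
  rw [map_sum, Finset.sum_mul]
  refine norm_sum_le_of_le _ fun k _ => ?_
  rw [fderiv_smul_eq]
  refine (norm_add_le _ _).trans ?_
  rw [norm_mul, norm_mul, RCLike.norm_conj, ← mul_add, mul_comm]
  gcongr
  exact PiLp.norm_apply_le x k

theorem dbar_eigen {l : ι → ℝ} {μ : ℝ} {g : EuclideanSpace ℂ ι → ℂ} {y : EuclideanSpace ℂ ι}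
    (hg : ContDiffAt ℝ ∞ g y)
    (h : ∀ᶠ z in 𝓝 y, dbar g (diagCLM (fun i => (l i : ℂ)) z) z = -(μ : ℂ) * g z) (k : ι) :
    dbar (dbar g (EuclideanSpace.single k 1)) (diagCLM (fun i => (l i : ℂ)) y) y =
      -((μ + l k : ℝ) : ℂ) * dbar g (EuclideanSpace.single k 1) y := by
  rw [dbar_dbar_of_vectorField hg (diagCLM (fun i => (l i : ℂ))).hasFDerivAt h,
    dbar_neg_mul _ _ _ _ (hg.differentiableAt (by simp)), diagCLM_single, dbar_smul]
  simp
  ring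

theorem del_eigen {l : ι → ℝ} {μ : ℝ} {g : EuclideanSpace ℂ ι → ℂ} {y : EuclideanSpace ℂ ι}
    (hg : ContDiffAt ℝ ∞ g y)
    (h : ∀ᶠ z in 𝓝 y, dbar g (diagCLM (fun i => (l i : ℂ)) z) z = -(μ : ℂ) * g z) (k : ι) :
    dbar (del g (EuclideanSpace.single k 1)) (diagCLM (fun i => (l i : ℂ)) y) y =
      -(μ : ℂ) * del g (EuclideanSpace.single k 1) y := by
  rw [dbar_del_of_vectorField hg (diagCLM (fun i => (l i : ℂ))).hasFDerivAt h,
    del_neg_mul _ _ _ _ (hg.differentiableAt (by simp))]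

/-- A smooth eigenfunction with negative eigenvalue of the antiholomorphic derivative along a
diagonal linear vector field with positive eigenvalues is flat at the origin. -/
theorem isBigO_pow_of_eigen {l : ι → ℝ} (hl : ∀ i, 0 < l i) (n : ℕ) :
    ∀ (μ : ℝ) (_ : 0 < μ) (g : EuclideanSpace ℂ ι → ℂ)
      (_ : ∀ᶠ y in 𝓝 0, ContDiffAt ℝ ∞ g y)
      (_ : ∀ᶠ y in 𝓝 0, dbar g (diagCLM (fun i => (l i : ℂ)) y) y = -(μ : ℂ) * g y),
      g =O[𝓝 0] fun y => ‖y‖ ^ n := by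
  induction n with
  | zero =>
    intro μ hμ g hg _
    simp only [pow_zero]
    exact hg.self_of_nhds.continuousAt.norm.isBoundedUnder_le.isBigO_one ℝ
  | succ n ih =>
    intro μ hμ g hg h
    have hg0 : g 0 = 0 := by
      have := h.self_of_nhds
      rw [map_zero, dbar_zero, eq_comm, mul_eq_zero] at this
      exact this.resolve_left (by simpa using hμ.ne')
    have hE := hg.and h.eventually_nhds
    -- The induction runs over all `μ` and `g` at once, so it applies to the first derivatives,
    -- whose eigenvalues `-μ` and `-(μ + l k)` are still negative.
    have hD : (fun y => fderiv ℝ g y) =O[𝓝 0] fun y => ‖y‖ ^ n := by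
      have hs : (fun y => ∑ k, (‖del g (EuclideanSpace.single k 1) y‖ +
          ‖dbar g (EuclideanSpace.single k 1) y‖)) =O[𝓝 0] fun y => ‖y‖ ^ n := by
        refine IsBigO.fun_sum fun k _ => IsBigO.add (IsBigO.norm_left ?_) (IsBigO.norm_left ?_)
        · exact ih μ hμ _ (hg.mono fun y hy => contDiffAt_del hy _)
            (hE.mono fun y hy => del_eigen hy.1 hy.2 k)
        · exact ih (μ + l k) (add_pos hμ (hl k)) _ (hg.mono fun y hy => contDiffAt_dbar hy _)
            (hE.mono fun y hy => dbar_eigen hy.1 hy.2 k)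
      refine IsBigO.trans (IsBigO.of_norm_le fun y => ?_) hs
      exact norm_fderiv_le_sum g y
    obtain ⟨C, hC0, hC⟩ := hD.exists_nonneg
    obtain ⟨ρ, hρ, hb⟩ := nhds_basis_closedBall.eventually_iff.1 (hC.bound.and hg)
    refine IsBigO.of_bound C ?_
    filter_upwards [closedBall_mem_nhds 0 hρ] with y hy
    have hsub : closedBall (0 : EuclideanSpace ℂ ι) ‖y‖ ⊆ closedBall 0 ρ :=
      closedBall_subset_closedBall (mem_closedBall_zero_iff.1 hy)
    have := (convex_closedBall (0 : EuclideanSpace ℂ ι) ‖y‖).norm_image_sub_le_of_norm_fderiv_le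
      (𝕜 := ℝ) (f := g) (C := C * ‖y‖ ^ n) (x := 0) (y := y)
      (fun x hx => (hb (hsub hx)).2.differentiableAt (by simp)) (fun x hx => by
        refine (hb (hsub hx)).1.trans ?_
        rw [norm_pow, norm_norm]
        have := mem_closedBall_zero_iff.1 hx
        gcongr) (mem_closedBall_self (norm_nonneg _)) (by simp)
    rw [hg0, sub_zero, sub_zero] at this
    rw [norm_pow, norm_norm, pow_succ, ← mul_assoc]
    exact this

theorem hasDerivAt_diagCLM_exp (l : ι → ℝ) (y : EuclideanSpace ℂ ι) (t : ℂ) :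
    HasDerivAt (fun t => diagCLM (fun i => cexp (-(l i * t))) y)
      (-diagCLM (fun i => (l i : ℂ)) (diagCLM (fun i => cexp (-(l i * t))) y)) t := by
  rw [hasDerivAt_iff_hasFDerivAt, ← hasFDerivWithinAt_univ, hasFDerivWithinAt_euclidean]
  intro i
  rw [hasFDerivWithinAt_univ, hasFDerivAt_iff_hasDerivAt]
  simp only [diagCLM_apply]
  have h := (((hasDerivAt_id t).const_mul (l i : ℂ)).neg.cexp).mul_const (y i)
  convert! h using 1
  simp
  ring

theorem eq_zero_of_eigen {l : ι → ℝ} (hl : ∀ i, 0 < l i) {μ : ℝ} (hμ : 0 < μ) {r : ℝ}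
    {g : EuclideanSpace ℂ ι → ℂ} (hg : ∀ y ∈ ball 0 r, ContDiffAt ℝ ∞ g y)
    (h : ∀ y ∈ ball 0 r, dbar g (diagCLM (fun i => (l i : ℂ)) y) y = -(μ : ℂ) * g y)
    {y : EuclideanSpace ℂ ι} (hy : y ∈ ball 0 r) : g y = 0 := by
  have hr : 0 < r := pos_of_mem_ball hy
  obtain ⟨l₀, hl₀, hle⟩ : ∃ l₀ : ℝ, 0 < l₀ ∧ ∀ i, l₀ ≤ l i := by
    rcases isEmpty_or_nonempty ι with hι | hι
    · exact ⟨1, one_pos, fun i => isEmptyElim i⟩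
    · obtain ⟨i, hi⟩ := Finite.exists_min l
      exact ⟨l i, hl i, hi⟩
  set c : ℂ → EuclideanSpace ℂ ι := fun t => diagCLM (fun i => cexp (-(l i * t))) y with hc
  have hcn : ∀ t : ℂ, 0 ≤ t.re → ‖c t‖ ≤ Real.exp (-(l₀ * t.re)) * ‖y‖ := fun t ht =>
    norm_diagCLM_le (Real.exp_pos _).le (fun i => by
      rw [norm_exp]
      simp only [neg_re, mul_re, ofReal_re, ofReal_im, zero_mul, sub_zero]
      gcongr
      exact hle i) y
  have hcy : ∀ t : ℂ, 0 ≤ t.re → ‖c t‖ ≤ ‖y‖ := fun t ht =>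
    (hcn t ht).trans (mul_le_of_le_one_left (norm_nonneg _)
      (Real.exp_le_one_iff.2 (neg_nonpos.2 (by positivity))))
  have hcb : ∀ t : ℂ, 0 ≤ t.re → c t ∈ ball (0 : EuclideanSpace ℂ ι) r := fun t ht =>
    mem_ball_zero_iff.2 ((hcy t ht).trans_lt (mem_ball_zero_iff.1 hy))
  -- An antiholomorphic integrating factor: ∂̄(g ∘ c) = μ (g ∘ c), since c follows the field
  -- backwards, and ∂̄q = -μ q, so the product is holomorphic.
  set q : ℂ → ℂ := fun t => cexp (-(μ : ℂ) * (starRingEnd ℂ) t) with hq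
  have hqd : ∀ t, HasFDerivAt q
      (q t • (-(μ : ℂ)) • (conjCLE : ℂ →L[ℝ] ℂ)) t := fun t =>
    (conjCLE.hasFDerivAt.const_mul (-(μ : ℂ))).cexp
  have hqn : ∀ t : ℂ, ‖q t‖ = Real.exp (-(μ * t.re)) := fun t => by
    simp [hq, norm_exp]
  have hqn1 : ∀ t : ℂ, 0 ≤ t.re → ‖q t‖ ≤ 1 := fun t ht => by
    rw [hqn]
    exact Real.exp_le_one_iff.2 (neg_nonpos.2 (by positivity))
  set k : ℂ → ℂ := fun t => (g ∘ c) t * q t with hk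
  have hcd : ∀ t, HasDerivAt c (-diagCLM (fun i => (l i : ℂ)) (c t)) t :=
    hasDerivAt_diagCLM_exp l y
  have hkd : ∀ t : ℂ, 0 ≤ t.re → DifferentiableAt ℂ k t := by
    intro t ht
    have h1 : DifferentiableAt ℝ g (c t) := (hg _ (hcb t ht)).differentiableAt (by simp)
    have h2 : DifferentiableAt ℝ (g ∘ c) t :=
      h1.comp t (hasFDerivAt_real_of_hasDerivAt (hcd t)).differentiableAt
    refine differentiableAt_of_dbar_one_eq_zero (h2.mul (hqd t).differentiableAt) ?_
    have h3 : dbar q 1 t = -μ * q t := by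
      simp only [dbar]
      rw [(hqd t).fderiv]
      simp
      linear_combination (q t * μ / 2) * I_sq
    rw [hk, dbar_mul _ h2 (hqd t).differentiableAt, h3, dbar_comp h1 (hcd t),
      ← neg_one_smul ℂ (diagCLM _ _), dbar_smul, h _ (hcb t ht)]
    simp
    ring
  obtain ⟨C, hC⟩ : ∃ C, ∀ z ∈ closedBall (0 : EuclideanSpace ℂ ι) ‖y‖, ‖g z‖ ≤ C :=
    (isCompact_closedBall _ _).exists_bound_of_continuousOn fun z hz =>
      (hg z (mem_ball_zero_iff.2 ((mem_closedBall_zero_iff.1 hz).trans_lt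
        (mem_ball_zero_iff.1 hy)))).continuousAt.continuousWithinAt
  have hkC : ∀ t : ℂ, 0 ≤ t.re → ‖k t‖ ≤ C := fun t ht => by
    have h1 := hC _ (mem_closedBall_zero_iff.2 (hcy t ht))
    simp only [hk, norm_mul]
    exact (mul_le_of_le_one_right (norm_nonneg _) (hqn1 t ht)).trans h1
  have hdec : SuperpolynomialDecay atTop Real.exp fun x : ℝ => ‖k x‖ := by
    intro n
    -- Flatness of order m gives decay like e^{-m l₀ x}, which beats e^{nx} as soon as m l₀ > n.
    obtain ⟨m, hm⟩ := exists_nat_gt (n / l₀)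
    rw [div_lt_iff₀ hl₀] at hm
    have hc0 : Tendsto (fun x : ℝ => c x) atTop (𝓝 0) := by
      have h1 : Tendsto (fun x : ℝ => Real.exp (-(l₀ * x)) * ‖y‖) atTop (𝓝 0) := by
        rw [← zero_mul ‖y‖]
        exact (Real.tendsto_exp_neg_atTop_nhds_zero.comp
          (tendsto_id.const_mul_atTop hl₀)).mul_const _
      refine squeeze_zero_norm' ?_ h1
      filter_upwards [eventually_ge_atTop 0] with x hx
      simpa using hcn x (by simpa using hx)
    have hO := (isBigO_pow_of_eigen hl m μ hμ g
      ((ball_mem_nhds 0 hr : ball (0 : EuclideanSpace ℂ ι) r ∈ 𝓝 0) |> fun hb =>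
        Filter.mem_of_superset hb hg)
      (Filter.mem_of_superset (ball_mem_nhds 0 hr) h)).comp_tendsto hc0
    obtain ⟨D, hD0, hD⟩ := hO.exists_nonneg
    have h2 : Tendsto (fun x : ℝ => D * ‖y‖ ^ m * Real.exp (-((m * l₀ - n) * x))) atTop (𝓝 0) := by
      rw [← mul_zero (D * ‖y‖ ^ m)]
      exact (Real.tendsto_exp_neg_atTop_nhds_zero.comp
        (tendsto_id.const_mul_atTop (sub_pos.2 hm))).const_mul _
    refine squeeze_zero' (Eventually.of_forall fun x => by positivity) ?_ h2
    filter_upwards [eventually_ge_atTop 0, hD.bound] with x hx hDx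
    have hx' : 0 ≤ (x : ℂ).re := by simpa using hx
    have h3 := hcn x hx'
    rw [ofReal_re] at h3
    have h4 : ‖k x‖ ≤ D * (Real.exp (-(l₀ * x)) * ‖y‖) ^ m := by
      simp only [hk, norm_mul]
      refine (mul_le_of_le_one_right (norm_nonneg _) (hqn1 x hx')).trans (hDx.trans ?_)
      simp only [Function.comp_apply, norm_pow, norm_norm]
      gcongr
    calc Real.exp x ^ n * ‖k x‖
        ≤ Real.exp x ^ n * (D * (Real.exp (-(l₀ * x)) * ‖y‖) ^ m) := by gcongr
      _ = D * ‖y‖ ^ m * (Real.exp x ^ n * Real.exp (-(l₀ * x)) ^ m) := by ring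
      _ = _ := by
        rw [← Real.exp_nat_mul, ← Real.exp_nat_mul, ← Real.exp_add]
        congr 2
        ring
  have hcl : closure {z : ℂ | 0 < z.re} = {z : ℂ | 0 ≤ z.re} := closure_setOfPred_lt_re 0
  have hzero := PhragmenLindelof.eq_zero_on_right_half_plane_of_superexponential_decay (f := k)
    (DifferentiableOn.diffContOnCl fun t ht =>
      (hkd t (by rw [hcl] at ht; exact ht)).differentiableWithinAt)
    ⟨0, by norm_num, 0, by
      refine IsBigO.of_bound C ?_
      refine eventually_inf_principal.2 (Eventually.of_forall fun t ht => ?_)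
      simpa using hkC t (le_of_lt ht)⟩ hdec ⟨C, fun x => hkC _ (by simp)⟩
  have h0 : k 0 = 0 := hzero (by simp)
  have hc00 : c 0 = y := by
    ext i
    simp [hc]
  simpa [hk, hq, hc00] using h0

/-- A smooth function near the origin annihilated by the antiholomorphic derivative along a
diagonal linear vector field whose eigenvalues have positive ratios is holomorphic. -/
theorem dbar_eq_zero_of_linear_vectorField {α : ι → ℂ}
    (hα : ∀ j k, ∃ s : ℝ, 0 < s ∧ α j / α k = (s : ℂ)) {r : ℝ}
    {g : EuclideanSpace ℂ ι → ℂ} (hg : ∀ y ∈ ball 0 r, ContDiffAt ℝ ∞ g y)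
    (h : ∀ y ∈ ball 0 r, dbar g (diagCLM α y) y = 0)
    {y : EuclideanSpace ℂ ι} (hy : y ∈ ball 0 r) (e : EuclideanSpace ℂ ι) : dbar g e y = 0 := by
  -- Take c to be one of the eigenvalues and l the ratios to it. The factor c leaves ∂̄_V only as
  -- the nonzero scalar c̄.
  obtain ⟨c, l, hc, hl, hcl⟩ : ∃ (c : ℂ) (l : ι → ℝ), c ≠ 0 ∧ (∀ i, 0 < l i) ∧
      ∀ i, α i = c * l i := by
    rcases isEmpty_or_nonempty ι with hι | ⟨⟨i⟩⟩
    · exact ⟨1, fun _ => 1, one_ne_zero, fun i => isEmptyElim i, fun i => isEmptyElim i⟩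
    · have hi : α i ≠ 0 := by
        intro h0
        obtain ⟨s, hs, h1⟩ := hα i i
        rw [h0, div_zero, eq_comm, ofReal_eq_zero] at h1
        exact hs.ne' h1
      choose s hs h1 using fun j => hα j i
      exact ⟨α i, s, hi, hs, fun j => by rw [← h1, mul_div_cancel₀ _ hi]⟩
  have h' : ∀ y ∈ ball 0 r, dbar g (diagCLM (fun i => (l i : ℂ)) y) y = 0 := by
    intro z hz
    have h1 : diagCLM α z = c • diagCLM (fun i => (l i : ℂ)) z := by
      ext i
      simp [hcl, mul_assoc]
    have h2 := h z hz
    rw [h1, dbar_smul, mul_eq_zero] at h2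
    exact h2.resolve_left (by simpa using hc)
  have hk : ∀ k, dbar g (EuclideanSpace.single k 1) y = 0 := fun k =>
    eq_zero_of_eigen hl (hl k) (fun z hz => contDiffAt_dbar (hg z hz) _) (fun z hz => by
      -- The function itself has eigenvalue 0, so its k-th antiholomorphic derivative has eigenvalue
      -- `-l k`, which is negative.
      have := dbar_eigen (μ := 0) (hg z hz) (l := l)
        (Filter.mem_of_superset (isOpen_ball.mem_nhds hz) fun x hx => by simpa using h' x hx) k
      simpa using this) hy
  rw [← sum_smul_single e, dbar_sum]
  exact Finset.sum_eq_zero fun k _ => by rw [dbar_smul, hk, mul_zero]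

end LinearCriticalPoint

/-! ### Propagation of holomorphy along an integral curve in a chart. -/

section Propagation

open Complex Filter Metric

variable {E : Type*} [NormedAddCommGroup E] [NormedSpace ℂ E]

theorem dbar_dbar_comp {g : E → ℂ} {γ W : ℂ → E} {v w : E} {ζ : ℂ}
    (hg : ContDiffAt ℝ ∞ g (γ ζ)) (hγ : HasDerivAt γ v ζ) (hW : HasDerivAt W w ζ) :
    DifferentiableAt ℝ (fun z => dbar g (W z) (γ z)) ζ ∧
    dbar (fun z => dbar g (W z) (γ z)) 1 ζ =
      dbar (dbar g (W ζ)) v (γ ζ) + dbar g w (γ ζ) := by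
  have h1 := fderiv_dbar_apply hg (hasFDerivAt_real_of_hasDerivAt hγ)
    (hasFDerivAt_real_of_hasDerivAt hW)
  have h2 := fderiv_dbar_apply (x := γ ζ) hg (hasFDerivAt_id (γ ζ)) (hasFDerivAt_const (W ζ) (γ ζ))
  have e2 : fderiv ℝ (dbar g (W ζ)) (γ ζ) = _ := h2.fderiv
  refine ⟨h1.differentiableAt, ?_⟩
  rw [dbar, h1.fderiv]
  simp only [dbar] at e2 ⊢
  rw [e2]
  simp
  simp only [smul_smul, I_mul_I, neg_smul, one_smul, map_neg]
  linear_combination (- fderiv ℝ g (γ ζ) w / 4) * I_sq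

/-- Vanishing of the antiholomorphic derivative propagates along integral curves of a
holomorphic vector field. -/
theorem exists_ball_dbar_eq_zero_of_eventually [CompleteSpace E] {U : Set E} (hU : IsOpen U)
    {V : E → E} (hV : ∀ y ∈ U, ContDiffAt ℂ ω V y) {g : E → ℂ}
    (hg : ∀ y ∈ U, ContDiffAt ℝ ∞ g y) (h : ∀ y ∈ U, dbar g (V y) y = 0)
    {γ : ℂ → E} {ζ₀ : ℂ} (hγ₀ : γ ζ₀ ∈ U) (hγ : ∀ᶠ ζ in 𝓝 ζ₀, HasDerivAt γ (V (γ ζ)) ζ) :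
    ∃ r > 0, ∀ ζ₁ ∈ ball ζ₀ r, (∀ᶠ ζ in 𝓝 ζ₁, ∀ e, dbar g e (γ ζ) = 0) →
      ∀ ζ ∈ ball ζ₀ r, ∀ e, dbar g e (γ ζ) = 0 := by
  have hV₀ := hV _ hγ₀
  -- Solving the equation coupled with its linearization, from `(γ ζ₀, id)`, produces the transport
  -- of vectors without differentiating a flow in its initial values.
  have hf : ContDiffAt ℂ 1 (fun p : E × (E →L[ℂ] E) => (V p.1, (fderiv ℂ V p.1).comp p.2))
      (γ ζ₀, ContinuousLinearMap.id ℂ E) := by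
    have h1 : ContDiffAt ℂ 1 (fun p : E × (E →L[ℂ] E) => V p.1)
        (γ ζ₀, ContinuousLinearMap.id ℂ E) :=
      (hV₀.of_le le_top).comp (γ ζ₀, ContinuousLinearMap.id ℂ E) contDiffAt_fst
    have h2 : ContDiffAt ℂ 1 (fun p : E × (E →L[ℂ] E) => fderiv ℂ V p.1)
        (γ ζ₀, ContinuousLinearMap.id ℂ E) :=
      (hV₀.fderiv_right (m := 1) le_top).comp (γ ζ₀, ContinuousLinearMap.id ℂ E) contDiffAt_fst
    exact h1.prodMk (h2.clm_comp contDiffAt_snd)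
  obtain ⟨ρ, hρ, p, hp₀, hp⟩ := exists_hasDerivAt_complex_of_contDiffAt hf ζ₀
  set Y : ℂ → E →L[ℂ] E := fun ζ => (p ζ).2 with hY
  have hx : ∀ ζ ∈ ball ζ₀ ρ, HasDerivAt (fun ζ => (p ζ).1) (V (p ζ).1) ζ := fun ζ hζ =>
    (ContinuousLinearMap.fst ℂ E (E →L[ℂ] E)).hasFDerivAt.comp_hasDerivAt ζ (hp ζ hζ)
  have hYd : ∀ ζ ∈ ball ζ₀ ρ, HasDerivAt Y ((fderiv ℂ V (p ζ).1).comp (Y ζ)) ζ := fun ζ hζ =>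
    (ContinuousLinearMap.snd ℂ E (E →L[ℂ] E)).hasFDerivAt.comp_hasDerivAt ζ (hp ζ hζ)
  have hball : ball ζ₀ ρ ∈ 𝓝 ζ₀ := ball_mem_nhds ζ₀ hρ
  have hγx : γ =ᶠ[𝓝 ζ₀] fun ζ => (p ζ).1 :=
    eventuallyEq_of_hasDerivAt_complex (hV₀.of_le le_top) (by rw [hp₀]) hγ
      (mem_of_superset hball hx)
  have hYu : ∀ᶠ ζ in 𝓝 ζ₀, IsUnit (Y ζ) := by
    refine (hYd ζ₀ (mem_ball_self hρ)).continuousAt.eventually (Units.isOpen.mem_nhds ?_)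
    simp only [hY, hp₀]
    exact isUnit_one
  have hγU : ∀ᶠ ζ in 𝓝 ζ₀, γ ζ ∈ U :=
    hγ.self_of_nhds.continuousAt.eventually (hU.mem_nhds hγ₀)
  obtain ⟨r, hr, hb⟩ := nhds_basis_ball.eventually_iff.1
    (hγ.and (hγx.and (hYu.and (hγU.and (eventually_mem_set.2 hball)))))
  refine ⟨r, hr, fun ζ₁ hζ₁ hz => ?_⟩
  have hk : ∀ e, DifferentiableOn ℂ (fun ζ => dbar g (Y ζ e) (γ ζ)) (ball ζ₀ r) := by
    intro e ζ hζ
    obtain ⟨b1, b2, -, b3, b4⟩ := hb hζ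
    have hYe : HasDerivAt (fun ζ => Y ζ e) (fderiv ℂ V (γ ζ) (Y ζ e)) ζ := by
      have := (hYd ζ b4).clm_apply (hasDerivAt_const ζ e)
      rw [show (p ζ).1 = γ ζ from b2.symm] at this
      simpa using this
    obtain ⟨c1, c2⟩ := dbar_dbar_comp (hg _ b3) b1 hYe
    refine (differentiableAt_of_dbar_one_eq_zero c1 ?_).differentiableWithinAt
    -- The commutator contributes -∂̄g(V' Y e), which cancels the term from the moving direction.
    rw [c2, dbar_dbar_of_vectorField (h := fun _ => 0) (hg _ b3)
      ((hV _ b3).differentiableAt (by simp)).hasFDerivAt (mem_of_superset (hU.mem_nhds b3) h)]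
    simp [dbar]
  intro ζ hζ e
  have hzero : ∀ e, dbar g (Y ζ e) (γ ζ) = 0 := fun e =>
    ((hk e).analyticOnNhd isOpen_ball).eqOn_zero_of_preconnected_of_eventuallyEq_zero
      (convex_ball ζ₀ r).isPreconnected hζ₁ (hz.mono fun ζ hζ => hζ _) hζ
  -- Since `Y ζ` is invertible, transported vectors exhaust all directions.
  obtain ⟨u, hu⟩ := (hb hζ).2.2.1
  have : Y ζ ((u⁻¹ : (E →L[ℂ] E)ˣ).1 e) = e := by
    rw [← hu, ← mul_apply_eq_comp, Units.mul_inv, one_apply_eq_self]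
  rw [← this]
  exact hzero _

end Propagation

/-! ### Passage between the manifold and holomorphic charts. -/

section ChartTransfer

open Complex Filter IsManifold

variable {E : Type*} [NormedAddCommGroup E] [NormedSpace ℂ E] {M : Type*} [TopologicalSpace M]
  [ChartedSpace E M]

/-- Smoothness of φ refers to the real structure of M, whereas the linearizing coordinates come from
the holomorphic atlas. -/
theorem mem_maximalAtlas_real {w : OpenPartialHomeomorph M E}
    (hw : w ∈ maximalAtlas 𝓘(ℂ, E) ω M) : w ∈ maximalAtlas 𝓘(ℝ, E) ∞ M := by
  have key : ∀ e : OpenPartialHomeomorph E E,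
      e ∈ contDiffGroupoid ω 𝓘(ℂ, E) → e ∈ contDiffGroupoid ∞ 𝓘(ℝ, E) := by
    intro e he
    rw [contDiffGroupoid, mem_groupoid_of_pregroupoid] at he ⊢
    simp only [contDiffPregroupoid] at he ⊢
    exact ⟨((show ContDiffOn ℂ ω _ _ from he.1).restrict_scalars ℝ).of_le le_top,
      ((show ContDiffOn ℂ ω _ _ from he.2).restrict_scalars ℝ).of_le le_top⟩
  exact fun e he => ⟨key _ (hw e he).1, key _ (hw e he).2⟩

theorem contDiffAt_comp_chart_symm {w : OpenPartialHomeomorph M E}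
    (hw : w ∈ maximalAtlas 𝓘(ℂ, E) ω M) {φ : M → ℂ} (hφ : ContMDiff 𝓘(ℝ, E) 𝓘(ℝ, ℂ) ∞ φ)
    {y : E} (hy : y ∈ w.target) : ContDiffAt ℝ ∞ (φ ∘ w.symm) y := by
  rw [← contMDiffAt_iff_contDiffAt]
  exact hφ.contMDiffAt.comp y (contMDiffAt_symm_of_mem_maximalAtlas (mem_maximalAtlas_real hw) hy)

theorem mdifferentiableAt_of_comp_chart_symm {w : OpenPartialHomeomorph M E}
    (hw : w ∈ maximalAtlas 𝓘(ℂ, E) ω M) {φ : M → ℂ} {p : M} (hp : p ∈ w.source)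
    (h : DifferentiableAt ℂ (φ ∘ w.symm) (w p)) : MDifferentiableAt 𝓘(ℂ, E) 𝓘(ℂ, ℂ) φ p := by
  refine (h.mdifferentiableAt.comp p (mdifferentiableAt_of_mem_maximalAtlas (maximalAtlas_subset_of_le le_top hw) hp)).congr_of_eventuallyEq ?_
  filter_upwards [w.open_source.mem_nhds hp] with z hz
  simp [w.left_inv hz]

theorem differentiableAt_comp_chart_symm {w : OpenPartialHomeomorph M E}
    (hw : w ∈ maximalAtlas 𝓘(ℂ, E) ω M) {φ : M → ℂ} {p : M} (hp : p ∈ w.source)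
    (h : MDifferentiableAt 𝓘(ℂ, E) 𝓘(ℂ, ℂ) φ p) : DifferentiableAt ℂ (φ ∘ w.symm) (w p) := by
  rw [← mdifferentiableAt_iff_differentiableAt]
  rw [← w.left_inv hp] at h
  exact h.comp (w p) (mdifferentiableAt_symm_of_mem_maximalAtlas (maximalAtlas_subset_of_le le_top hw) (w.map_source hp))

/-- The vector field `F` in the coordinates `w`. -/
noncomputable def fieldIn (w : OpenPartialHomeomorph M E)
    (F : (z : M) → TangentSpace 𝓘(ℂ, E) z) (y : E) : E :=
  mfderiv 𝓘(ℂ, E) 𝓘(ℂ, E) w (w.symm y) (F (w.symm y))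

theorem contDiffAt_fieldIn [IsManifold 𝓘(ℂ, E) ω M] {w : OpenPartialHomeomorph M E}
    (hw : w ∈ maximalAtlas 𝓘(ℂ, E) ω M) {F : (z : M) → TangentSpace 𝓘(ℂ, E) z}
    (hF : ContMDiff 𝓘(ℂ, E) 𝓘(ℂ, E).tangent ω (fun z => (⟨z, F z⟩ : TangentBundle 𝓘(ℂ, E) M)))
    {y : E} (hy : y ∈ w.target) : ContDiffAt ℂ ω (fieldIn w F) y := by
  have : IsManifold 𝓘(ℂ, E) 1 M := IsManifold.of_le (n := ω) le_top
  have h1 := (contMDiffOn_of_mem_maximalAtlas hw).contMDiffOn_tangentMapWithin (m := ω)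
    le_top w.open_source.uniqueMDiffOn
  have h2 : ContMDiffAt 𝓘(ℂ, E) 𝓘(ℂ, E).tangent ω
      (fun z => (⟨w.symm z, F (w.symm z)⟩ : TangentBundle 𝓘(ℂ, E) M)) y :=
    (hF.contMDiffAt (x := w.symm y)).comp y (contMDiffAt_symm_of_mem_maximalAtlas hw hy)
  have h3 : ContMDiffAt 𝓘(ℂ, E).tangent 𝓘(ℂ, E).tangent ω
      (tangentMapWithin 𝓘(ℂ, E) 𝓘(ℂ, E) w w.source)
      (⟨w.symm y, F (w.symm y)⟩ : TangentBundle 𝓘(ℂ, E) M) :=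
    h1.contMDiffAt ((w.open_source.preimage
      (FiberBundle.continuous_proj E (TangentSpace 𝓘(ℂ, E) (M := M)))).mem_nhds
        (w.map_target hy))
  have h4 := ((contMDiff_snd_tangentBundle_modelSpace E 𝓘(ℂ, E)).contMDiffAt.comp y
    (h3.comp y h2))
  rw [← contMDiffAt_iff_contDiffAt]
  refine h4.congr_of_eventuallyEq ?_
  filter_upwards [w.open_target.mem_nhds hy] with z hz
  change (mfderiv 𝓘(ℂ, E) 𝓘(ℂ, E) w (w.symm z) : E →L[ℂ] E) (F (w.symm z) : E) =
    (mfderivWithin 𝓘(ℂ, E) 𝓘(ℂ, E) w w.source (w.symm z) : E →L[ℂ] E) (F (w.symm z) : E)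
  rw [mfderivWithin_of_isOpen w.open_source (w.map_target hz)]

theorem fieldIn_apply (w : OpenPartialHomeomorph M E) (F : (z : M) → TangentSpace 𝓘(ℂ, E) z)
    {p : M} (hp : p ∈ w.source) :
    fieldIn w F (w p) = (mfderiv 𝓘(ℂ, E) 𝓘(ℂ, E) w p : E →L[ℂ] E) (F p : E) := by
  have : ∀ q, q = p → (mfderiv 𝓘(ℂ, E) 𝓘(ℂ, E) w q : E →L[ℂ] E) (F q : E) =
      (mfderiv 𝓘(ℂ, E) 𝓘(ℂ, E) w p : E →L[ℂ] E) (F p : E) := by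
    rintro _ rfl
    rfl
  exact this _ (w.left_inv hp)

theorem hasDerivAt_chart_comp {w : OpenPartialHomeomorph M E}
    (hw : w ∈ maximalAtlas 𝓘(ℂ, E) ω M) {F : (z : M) → TangentSpace 𝓘(ℂ, E) z}
    {γ : ℂ → M} {ζ : ℂ}
    (hγ : HasMFDerivAt 𝓘(ℂ, ℂ) 𝓘(ℂ, E) γ ζ ((1 : ℂ →L[ℂ] ℂ).smulRight (F (γ ζ))))
    (hζ : γ ζ ∈ w.source) : HasDerivAt (w ∘ γ) (fieldIn w F (w (γ ζ))) ζ := by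
  have h := (mdifferentiableAt_of_mem_maximalAtlas (maximalAtlas_subset_of_le le_top hw) hζ).hasMFDerivAt.comp ζ hγ
  let v : E := F (γ ζ)
  let A : E →L[ℂ] E := mfderiv 𝓘(ℂ, E) 𝓘(ℂ, E) w (γ ζ)
  have h' : HasFDerivAt (w ∘ γ) (A.comp ((1 : ℂ →L[ℂ] ℂ).smulRight v)) ζ := hasMFDerivAt_iff_hasFDerivAt.1 h
  refine h'.hasDerivAt.congr_deriv ?_
  rw [fieldIn_apply w F hζ]
  change A ((1 : ℂ) • v) = A v
  rw [one_smul]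

theorem hasMFDerivAt_chart_symm_comp {w : OpenPartialHomeomorph M E}
    (hw : w ∈ maximalAtlas 𝓘(ℂ, E) ω M) {F : (z : M) → TangentSpace 𝓘(ℂ, E) z}
    {y : ℂ → E} {ζ : ℂ} (hy : HasDerivAt y (fieldIn w F (y ζ)) ζ) (hζ : y ζ ∈ w.target) :
    HasMFDerivAt 𝓘(ℂ, ℂ) 𝓘(ℂ, E) (w.symm ∘ y) ζ
      ((1 : ℂ →L[ℂ] ℂ).smulRight (F ((w.symm ∘ y) ζ))) := by
  have h := (mdifferentiableAt_symm_of_mem_maximalAtlas (maximalAtlas_subset_of_le le_top hw) hζ).hasMFDerivAt.comp ζ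
    (hasMFDerivAt_iff_hasFDerivAt.2 hy.hasFDerivAt)
  have hwm : w.MDifferentiable 𝓘(ℂ, E) 𝓘(ℂ, E) :=
    ⟨fun p hp => (mdifferentiableAt_of_mem_maximalAtlas (maximalAtlas_subset_of_le le_top hw) hp).mdifferentiableWithinAt,
      fun p hp => (mdifferentiableAt_symm_of_mem_maximalAtlas (maximalAtlas_subset_of_le le_top hw) hp).mdifferentiableWithinAt⟩
  have hc := hwm.symm_comp_deriv (w.map_target hζ)
  rw [w.right_inv hζ] at hc
  let A : E →L[ℂ] E := mfderiv 𝓘(ℂ, E) 𝓘(ℂ, E) w.symm (y ζ)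
  let v : E := F (w.symm (y ζ))
  have hF : A (fieldIn w F (y ζ)) = v := DFunLike.congr_fun hc (F (w.symm (y ζ)))
  refine h.congr_mfderiv (Eq.symm ?_)
  refine ContinuousLinearMap.ext_ring ?_
  change (1 : ℂ) • v = A ((1 : ℂ) • fieldIn w F (y ζ))
  rw [one_smul, one_smul, hF]

end ChartTransfer

/-! ### From critical points to the whole manifold. -/

section Forelli

open Complex Filter Metric IsManifold

variable {N : ℕ} {M : Type*} [TopologicalSpace M] [ChartedSpace (EuclideanSpace ℂ (Fin N)) M]
  {F : (z : M) → TangentSpace 𝓘(ℂ, EuclideanSpace ℂ (Fin N)) z} {φ : M → ℂ}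

theorem IsComplexIntegralCurveOn.continuousAt {γ : ℂ → M} {D : Set ℂ}
    (hγ : IsComplexIntegralCurveOn F γ D) {ζ : ℂ} (hζ : ζ ∈ D) : ContinuousAt γ ζ :=
  (hγ ζ hζ).continuousAt

theorem OnCommonIntegralCurve.symm {p q : M} (h : OnCommonIntegralCurve F p q) :
    OnCommonIntegralCurve F q p := by
  obtain ⟨D, γ, hD, hDc, hγ, hp, hq⟩ := h
  exact ⟨D, γ, hD, hDc, hγ, hq, hp⟩

theorem IsComplexIntegralCurveOn.eventually_mem_chart_source {γ : ℂ → M} {D : Set ℂ}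
    (hD : IsOpen D) (hγ : IsComplexIntegralCurveOn F γ D) {ζ : ℂ} (hζ : ζ ∈ D) :
    ∀ᶠ z in 𝓝 ζ, z ∈ D ∧ γ z ∈ (chartAt (EuclideanSpace ℂ (Fin N)) (γ ζ)).source :=
  (hD.eventually_mem hζ).and ((hγ.continuousAt hζ).eventually (chart_source_mem_nhds _ _))

/-- `φ` is holomorphic at `p` and at the nearby points of all integral curves of `F` through
`p`. -/
def IsHolomorphicAlong (F : (z : M) → TangentSpace 𝓘(ℂ, EuclideanSpace ℂ (Fin N)) z) (φ : M → ℂ)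
    (p : M) : Prop :=
  MDifferentiableAt 𝓘(ℂ, EuclideanSpace ℂ (Fin N)) 𝓘(ℂ, ℂ) φ p ∧
    ∀ (D : Set ℂ) (γ : ℂ → M) (ζ : ℂ), IsOpen D → IsComplexIntegralCurveOn F γ D → ζ ∈ D →
      γ ζ = p →
      ∀ᶠ z in 𝓝 ζ, MDifferentiableAt 𝓘(ℂ, EuclideanSpace ℂ (Fin N)) 𝓘(ℂ, ℂ) φ (γ z)

theorem IsHolomorphicAlong.of_eventually {p : M}
    (h : ∀ᶠ z in 𝓝 p, MDifferentiableAt 𝓘(ℂ, EuclideanSpace ℂ (Fin N)) 𝓘(ℂ, ℂ) φ z) :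
    IsHolomorphicAlong F φ p :=
  ⟨h.self_of_nhds, fun _ _ _ _ hγ hζ hp => (hγ.continuousAt hζ).eventually (hp ▸ h)⟩

variable [IsManifold 𝓘(ℂ, EuclideanSpace ℂ (Fin N)) ω M]

theorem IsFHolomorphic.dbar_fieldIn_eq_zero (hF : IsHolomorphicVectorField F)
    (hs : ContMDiff 𝓘(ℝ, EuclideanSpace ℂ (Fin N)) 𝓘(ℝ, ℂ) ∞ φ) (hφ : IsFHolomorphic F φ)
    {w : OpenPartialHomeomorph M (EuclideanSpace ℂ (Fin N))}
    (hw : w ∈ maximalAtlas 𝓘(ℂ, EuclideanSpace ℂ (Fin N)) ω M)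
    {y : EuclideanSpace ℂ (Fin N)} (hy : y ∈ w.target) :
    dbar (φ ∘ w.symm) (fieldIn w F y) y = 0 := by
  obtain ⟨r, hr, c, hc0, hc⟩ := exists_hasDerivAt_complex_of_contDiffAt
    ((contDiffAt_fieldIn hw hF hy).of_le le_top) 0
  have hct : ∀ᶠ ζ in 𝓝 0, c ζ ∈ w.target :=
    (hc 0 (mem_ball_self hr)).continuousAt.eventually (w.open_target.mem_nhds (by rwa [hc0]))
  obtain ⟨ρ, hρ, hb⟩ := nhds_basis_ball.eventually_iff.1
    (hct.and (eventually_mem_set.2 (ball_mem_nhds 0 hr)))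
  have hγ : IsComplexIntegralCurveOn F (w.symm ∘ c) (ball 0 ρ) := fun ζ hζ =>
    hasMFDerivAt_chart_symm_comp hw (hc ζ (hb hζ).2) (hb hζ).1
  have hd : DifferentiableAt ℂ ((φ ∘ w.symm) ∘ c) 0 :=
    (hφ _ _ isOpen_ball hγ).differentiableAt (ball_mem_nhds 0 hρ)
  have h1 := dbar_eq_zero_of_differentiableAt hd 1
  have h2 : DifferentiableAt ℝ (φ ∘ w.symm) (c 0) := by
    rw [hc0]
    exact (contDiffAt_comp_chart_symm hw hs hy).differentiableAt (by simp)
  rwa [dbar_comp h2 (hc 0 (mem_ball_self hr)), hc0] at h1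

theorem IsForelliCriticalPoint.eventually_mdifferentiableAt (hF : IsHolomorphicVectorField F)
    (hs : ContMDiff 𝓘(ℝ, EuclideanSpace ℂ (Fin N)) 𝓘(ℝ, ℂ) ∞ φ) (hφ : IsFHolomorphic F φ)
    {z₀ : M} (hz : IsForelliCriticalPoint F z₀) :
    ∀ᶠ z in 𝓝 z₀, MDifferentiableAt 𝓘(ℂ, EuclideanSpace ℂ (Fin N)) 𝓘(ℂ, ℂ) φ z := by
  obtain ⟨hcrit, -, α, ⟨w, hw, hz₀, hlin⟩, hα⟩ := hz
  have hA : ∀ y ∈ w.target, fieldIn w F y = diagCLM α y := by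
    intro y hy
    have h1 := hlin _ (w.map_target hy)
    rw [w.right_inv hy] at h1
    exact h1
  have hw₀ : w z₀ = 0 := by
    have h1 : diagCLM α (w z₀) = 0 := by
      rw [← hA _ (w.map_source hz₀), fieldIn_apply w F hz₀, show F z₀ = 0 from hcrit]
      exact map_zero _
    ext i
    have h2 : α i * w z₀ i = 0 := by
      rw [← diagCLM_apply, h1, PiLp.zero_apply]
    refine (mul_eq_zero.1 h2).resolve_left fun h0 => ?_
    obtain ⟨s, hs, h3⟩ := hα i i
    rw [h0, div_zero, eq_comm, ofReal_eq_zero] at h3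
    exact hs.ne' h3
  have hnhds : w.target ∈ 𝓝 (0 : EuclideanSpace ℂ (Fin N)) :=
    w.open_target.mem_nhds (hw₀ ▸ w.map_source hz₀)
  obtain ⟨r, hr, hrt⟩ := nhds_basis_ball.mem_iff.1 hnhds
  have hball : ∀ᶠ z in 𝓝 z₀, w z ∈ ball (0 : EuclideanSpace ℂ (Fin N)) r :=
    (w.continuousAt hz₀).eventually (by rw [hw₀]; exact ball_mem_nhds 0 hr)
  filter_upwards [hball, w.open_source.mem_nhds hz₀] with z hz hzs
  have hsm : ∀ y ∈ ball (0 : EuclideanSpace ℂ (Fin N)) r, ContDiffAt ℝ ∞ (φ ∘ w.symm) y :=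
    fun y hy => contDiffAt_comp_chart_symm hw hs (hrt hy)
  refine mdifferentiableAt_of_comp_chart_symm hw hzs
    (differentiableAt_of_dbar_eq_zero ((hsm _ hz).differentiableAt (by simp)) fun e => ?_)
  refine dbar_eq_zero_of_linear_vectorField hα hsm (fun y hy => ?_) hz e
  rw [← hA y (hrt hy)]
  exact hφ.dbar_fieldIn_eq_zero hF hs hw (hrt hy)

/-- The radius is fixed before `ζ₁`, so that `ζ₀` may be a limit point of the good times; this makes
the set of good times relatively closed. -/
theorem IsComplexIntegralCurveOn.exists_ball_mdifferentiableAt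
    (hF : IsHolomorphicVectorField F)
    (hs : ContMDiff 𝓘(ℝ, EuclideanSpace ℂ (Fin N)) 𝓘(ℝ, ℂ) ∞ φ) (hφ : IsFHolomorphic F φ)
    {γ : ℂ → M} {D : Set ℂ} (hD : IsOpen D) (hγ : IsComplexIntegralCurveOn F γ D)
    {ζ₀ : ℂ} (hζ₀ : ζ₀ ∈ D) :
    ∃ r > 0, ∀ ζ₁ ∈ ball ζ₀ r,
      (∀ᶠ ζ in 𝓝 ζ₁, MDifferentiableAt 𝓘(ℂ, EuclideanSpace ℂ (Fin N)) 𝓘(ℂ, ℂ) φ (γ ζ)) →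
      ∀ ζ ∈ ball ζ₀ r, MDifferentiableAt 𝓘(ℂ, EuclideanSpace ℂ (Fin N)) 𝓘(ℂ, ℂ) φ (γ ζ) := by
  set w := chartAt (EuclideanSpace ℂ (Fin N)) (γ ζ₀) with hwdef
  have hw : w ∈ maximalAtlas 𝓘(ℂ, EuclideanSpace ℂ (Fin N)) ω M := chart_mem_maximalAtlas _
  have hsrc := hγ.eventually_mem_chart_source hD hζ₀
  rw [← hwdef] at hsrc
  obtain ⟨r, hr, h⟩ := exists_ball_dbar_eq_zero_of_eventually w.open_target
    (fun y hy => contDiffAt_fieldIn hw hF hy) (fun y hy => contDiffAt_comp_chart_symm hw hs hy)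
    (fun y hy => hφ.dbar_fieldIn_eq_zero hF hs hw hy) (γ := w ∘ γ) (ζ₀ := ζ₀)
    (w.map_source (mem_chart_source _ _))
    (hsrc.mono fun ζ hζ => hasDerivAt_chart_comp hw (hγ ζ hζ.1) hζ.2)
  obtain ⟨ρ, hρ, hb⟩ := nhds_basis_ball.eventually_iff.1
    (hsrc.and (eventually_mem_set.2 (ball_mem_nhds ζ₀ hr)))
  refine ⟨ρ, hρ, fun ζ₁ hζ₁ h1 ζ hζ => ?_⟩
  have h2 : ∀ᶠ ζ in 𝓝 ζ₁, ∀ e, dbar (φ ∘ w.symm) e ((w ∘ γ) ζ) = 0 := by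
    filter_upwards [h1, isOpen_ball.mem_nhds hζ₁] with ζ h3 h4 e
    exact dbar_eq_zero_of_differentiableAt
      (differentiableAt_comp_chart_symm hw (hb h4).1.2 h3) e
  refine mdifferentiableAt_of_comp_chart_symm hw (hb hζ).1.2
    (differentiableAt_of_dbar_eq_zero ?_ (h ζ₁ (hb hζ₁).2 h2 ζ (hb hζ).2))
  exact (contDiffAt_comp_chart_symm hw hs (w.map_source (hb hζ).1.2)).differentiableAt (by simp)

theorem IsComplexIntegralCurveOn.eventually_mdifferentiableAt
    (hF : IsHolomorphicVectorField F)
    (hs : ContMDiff 𝓘(ℝ, EuclideanSpace ℂ (Fin N)) 𝓘(ℝ, ℂ) ∞ φ) (hφ : IsFHolomorphic F φ)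
    {γ : ℂ → M} {D : Set ℂ} (hD : IsOpen D) (hDc : IsPreconnected D)
    (hγ : IsComplexIntegralCurveOn F γ D) {ζ₀ : ℂ} (hζ₀ : ζ₀ ∈ D)
    (h : ∀ᶠ ζ in 𝓝 ζ₀, MDifferentiableAt 𝓘(ℂ, EuclideanSpace ℂ (Fin N)) 𝓘(ℂ, ℂ) φ (γ ζ))
    {ζ₁ : ℂ} (hζ₁ : ζ₁ ∈ D) :
    ∀ᶠ ζ in 𝓝 ζ₁, MDifferentiableAt 𝓘(ℂ, EuclideanSpace ℂ (Fin N)) 𝓘(ℂ, ℂ) φ (γ ζ) := by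
  refine hDc.subset_of_closure_inter_subset (u := {ζ | ∀ᶠ ζ' in 𝓝 ζ,
    MDifferentiableAt 𝓘(ℂ, EuclideanSpace ℂ (Fin N)) 𝓘(ℂ, ℂ) φ (γ ζ')})
    isOpen_setOfPred_eventually_nhds ⟨ζ₀, hζ₀, h⟩ ?_ hζ₁
  rintro ζ ⟨hcl, hζ⟩
  obtain ⟨r, hr, hball⟩ := hγ.exists_ball_mdifferentiableAt hF hs hφ hD hζ
  obtain ⟨ζ', h1, h2⟩ := mem_closure_iff_nhds.1 hcl _ (ball_mem_nhds ζ hr)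
  exact mem_of_superset (ball_mem_nhds ζ hr) (hball ζ' h1 h2)

/-- The equation is autonomous: a time shift of a solution is a solution, and local uniqueness in a
chart applies. -/
theorem IsComplexIntegralCurveOn.eventually_eq (hF : IsHolomorphicVectorField F)
    {γ₁ γ₂ : ℂ → M} {D₁ D₂ : Set ℂ} (hD₁ : IsOpen D₁) (hD₂ : IsOpen D₂)
    (hγ₁ : IsComplexIntegralCurveOn F γ₁ D₁) (hγ₂ : IsComplexIntegralCurveOn F γ₂ D₂)
    {ζ₁ ζ₂ : ℂ} (hζ₁ : ζ₁ ∈ D₁) (hζ₂ : ζ₂ ∈ D₂) (h : γ₁ ζ₁ = γ₂ ζ₂) :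
    ∀ᶠ ζ in 𝓝 ζ₂, γ₁ (ζ + (ζ₁ - ζ₂)) = γ₂ ζ := by
  set w := chartAt (EuclideanSpace ℂ (Fin N)) (γ₁ ζ₁) with hwdef
  have hw : w ∈ maximalAtlas 𝓘(ℂ, EuclideanSpace ℂ (Fin N)) ω M := chart_mem_maximalAtlas _
  have s1 := hγ₁.eventually_mem_chart_source hD₁ hζ₁
  have s2 := hγ₂.eventually_mem_chart_source hD₂ hζ₂
  rw [← h, ← hwdef] at s2
  rw [← hwdef] at s1
  have ht : Tendsto (fun ζ => ζ + (ζ₁ - ζ₂)) (𝓝 ζ₂) (𝓝 ζ₁) := by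
    have : ContinuousAt (fun ζ => ζ + (ζ₁ - ζ₂)) ζ₂ := by fun_prop
    simpa [ContinuousAt] using this
  replace s1 := ht.eventually s1
  have e1 := eventuallyEq_of_hasDerivAt_complex (f := fieldIn w F)
    (y₁ := fun ζ => w (γ₁ (ζ + (ζ₁ - ζ₂)))) (y₂ := w ∘ γ₂) (ζ₀ := ζ₂)
    ((contDiffAt_fieldIn hw hF (w.map_source s1.self_of_nhds.2)).of_le le_top)
    (by simp [h])
    (s1.mono fun ζ hζ => (hasDerivAt_chart_comp hw (hγ₁ _ hζ.1) hζ.2).comp_add_const ζ _)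
    (s2.mono fun ζ hζ => hasDerivAt_chart_comp hw (hγ₂ _ hζ.1) hζ.2)
  filter_upwards [e1, s1, s2] with ζ h1 h2 h3
  exact w.injOn h2.2 h3.2 h1

/-- Consecutive links of a chain use different curves through the same point. Uniqueness makes them
agree locally up to a time shift, so information along one curve serves for the next. -/
theorem IsHolomorphicAlong.of_onCommonIntegralCurve (hF : IsHolomorphicVectorField F)
    (hs : ContMDiff 𝓘(ℝ, EuclideanSpace ℂ (Fin N)) 𝓘(ℝ, ℂ) ∞ φ) (hφ : IsFHolomorphic F φ)
    {p q : M} (hp : IsHolomorphicAlong F φ p) (hpq : OnCommonIntegralCurve F p q) :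
    IsHolomorphicAlong F φ q := by
  obtain ⟨D, γ, hD, hDc, hγ, ⟨ζp, hζp, rfl⟩, ⟨ζq, hζq, rfl⟩⟩ := hpq
  have h := hγ.eventually_mdifferentiableAt hF hs hφ hD hDc.isPreconnected hζp
    (hp.2 D γ ζp hD hγ hζp rfl) hζq
  refine ⟨h.self_of_nhds, fun D' γ' ζ' hD' hγ' hζ' hq => ?_⟩
  have ht : Tendsto (fun ζ => ζ + (ζq - ζ')) (𝓝 ζ') (𝓝 ζq) := by
    have : ContinuousAt (fun ζ => ζ + (ζq - ζ')) ζ' := by fun_prop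
    simpa [ContinuousAt] using this
  filter_upwards [ht.eventually h, hγ.eventually_eq hF hD hD' hγ' hζq hζ' hq.symm] with ζ h1 h2
  rwa [← h2]

theorem IsHolomorphicAlong.of_reflTransGen (hF : IsHolomorphicVectorField F)
    (hs : ContMDiff 𝓘(ℝ, EuclideanSpace ℂ (Fin N)) 𝓘(ℝ, ℂ) ∞ φ) (hφ : IsFHolomorphic F φ)
    {p q : M} (hp : IsHolomorphicAlong F φ p)
    (hpq : Relation.ReflTransGen (OnCommonIntegralCurve F) p q) : IsHolomorphicAlong F φ q := by
  induction hpq with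
  | refl => exact hp
  | tail _ h ih => exact ih.of_onCommonIntegralCurve hF hs hφ h

theorem mdifferentiable_of_isFHolomorphic (hF : IsHolomorphicVectorField F)
    (hcrit : ∀ z : M, IsCriticalPoint F z → IsForelliCriticalPoint F z)
    (hsat : (⋃ z ∈ {z : M | IsCriticalPoint F z}, Sat F z) = Set.univ)
    (hs : ContMDiff 𝓘(ℝ, EuclideanSpace ℂ (Fin N)) 𝓘(ℝ, ℂ) ∞ φ) (hφ : IsFHolomorphic F φ) :
    MDifferentiable 𝓘(ℂ, EuclideanSpace ℂ (Fin N)) 𝓘(ℂ, ℂ) φ := by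
  intro p
  have hp : p ∈ ⋃ z ∈ {z : M | IsCriticalPoint F z}, Sat F z := hsat ▸ Set.mem_univ p
  simp only [Set.mem_iUnion] at hp
  obtain ⟨z₀, hz₀, L, ⟨⟨p₀, rfl⟩, hL⟩, hpL⟩ := hp
  have hnear := (hcrit z₀ hz₀).eventually_mdifferentiableAt hF hs hφ
  -- The leaf is met at a point q with a whole neighbourhood of holomorphy, so the propagation can
  -- start on every curve through q.
  obtain ⟨q, hqL, hq⟩ := hL _ (eventually_eventually_nhds.2 hnear)
  have : Std.Symm (OnCommonIntegralCurve F) := ⟨fun _ _ => OnCommonIntegralCurve.symm⟩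
  have hsymm : Relation.ReflTransGen (OnCommonIntegralCurve F) q p₀ := Std.Symm.symm _ _ hqL
  exact ((IsHolomorphicAlong.of_eventually hq).of_reflTransGen hF hs hφ (hsymm.trans hpL)).1

end Forelli

theorem mainTheorem4 {N : ℕ} {M : Type*} [TopologicalSpace M] [T2Space M]
    [ChartedSpace (EuclideanSpace ℂ (Fin N)) M]
    [IsManifold 𝓘(ℂ, EuclideanSpace ℂ (Fin N)) ω M]
    (F : (z : M) → TangentSpace 𝓘(ℂ, EuclideanSpace ℂ (Fin N)) z)
    (hF : IsHolomorphicVectorField F)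
    (hcrit : ∀ z : M, IsCriticalPoint F z → IsForelliCriticalPoint F z)
    (hsat : (⋃ z ∈ {z : M | IsCriticalPoint F z}, Sat F z) = Set.univ) :
    (∀ φ : M → ℂ, ContMDiff 𝓘(ℝ, EuclideanSpace ℂ (Fin N)) 𝓘(ℝ, ℂ) ∞ φ →
      IsFHolomorphic F φ →
      MDifferentiable 𝓘(ℂ, EuclideanSpace ℂ (Fin N)) 𝓘(ℂ, ℂ) φ) ∧
    (CompactSpace M → PreconnectedSpace M →
      ∀ φ : M → ℂ, ContMDiff 𝓘(ℝ, EuclideanSpace ℂ (Fin N)) 𝓘(ℝ, ℂ) ∞ φ →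
      IsFHolomorphic F φ →
        ∃ c : ℂ, ∀ z : M, φ z = c) := by
  refine ⟨fun φ hs hφ => mdifferentiable_of_isFHolomorphic hF hcrit hsat hs hφ,
    fun hc hp φ hs hφ => ?_⟩
  obtain ⟨c, hc⟩ := (mdifferentiable_of_isFHolomorphic hF hcrit hsat hs
    hφ).exists_eq_const_of_compactSpace
  exact ⟨c, fun z => congrFun hc z⟩
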